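/- Fix $\alpha_{sys}>0$. For a gain $\alpha>0$ let $V^\alpha$ be the symmetric coordination payoff $V^\alpha(x,x)=1+\alpha$, $V^\alpha(y,y)=1$, $V^\alpha(x,y)=V^\alpha(y,x)=0$. For a connected undirected graph $G$ on $N\ge 3$ agents and a profile $a\in\{x,y\}^N$ let $U_i^\alpha(a)=\sum_{j\sim i}V^\alpha(a_i,a_j)$, and let $W(a)=\sum_i U_i^{\alpha_{sys}}(a)$ be the welfare. Given action sets $\mathcal A_i\subseteq\{x,y\}$ and utilities $(U_i)$ on $\mathcal A=\prod_i\mathcal A_i$, log-linear learning with parameter $\beta>0$ is the Markov chain on $\mathcal A$ in which at each step one agent $i$, chosen uniformly at random, changes its action to $z\in\mathcal A_i$ with probability $e^{\beta U_i(z,a_{-i})}/\sum_{z'\in\mathcal A_i}e^{\beta U_i(z',a_{-i})}$; $\mathrm{LLL}(\mathcal A,(U_i))$ is the set of profiles (the stochastically stable states) whose probability under its unique stationary distribution has a positive limit as $\beta\to\infty$. Broad attacks: for a partition $S=(S_x,S_y)$ of the agents (either part may be empty) let $\tilde U_i^\alpha(a)=U_i^\alpha(a)+\mathbf 1(a_i=y)$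 for $i\in S_y$ and $\tilde U_i^\alpha(a)=U_i^\alpha(a)+(1+\alpha)\mathbf 1(a_i=x)$ for $i\in S_x$, and let $$R_b(\alpha,S;G)=1-\frac{\min_{a\in \mathrm{LLL}(\{x,y\}^N,(\tilde U_i^\alpha))}W(a)}{\max_{a\in\{x,y\}^N}W(a)},\qquad R_b^*(\alpha)=\sup_{N\ge3}\ \sup_{G}\ \sup_{S}\ R_b(\alpha,S;G).$$ Focused attacks: for disjoint sets $F_x,F_y$ of agents whose union is a nonempty strict subset of the agents, let $\mathcal A(F)$ be the set of profiles with $a_i=x$ on $F_x$ and $a_i=y$ on $F_y$, and let $$R_f(\alpha,F;G)=1-\frac{\min_{a\in \mathrm{LLL}(\mathcal A(F),(U_i^\alpha))}W(a)}{\max_{a\in\mathcal A(F)}W(a)},\qquad R_f^*(\alpha)=\sup_{N\ge3}\ \sup_{G}\ \sup_{F}\ R_f(\alpha,F;G).$$ Here $G$ runs over all connected undirected graphs on $N$ agents. Let $\gamma_f\in[0,1)$ and $\alpha>0$. If $R_f^*(\alpha)\le\gamma_f$, then $$R_b^*(\alpha)\ \ge\ R_b^*\!\left(\frac{1+\alpha_{sys}}{1-\gamma_f}-1\right).$$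 -/

import Mathlib

open Filter Topology

namespace CoordGame

/-- The two conventions an agent can choose from. -/
inductive Choice
  | x
  | y
  deriving DecidableEq

instance : Fintype Choice where
  elems := {Choice.x, Choice.y}
  complete := fun c => by cases c <;> simp

section Game

variable {V : Type*} [Fintype V] [DecidableEq V]

/-- The symmetric `2 × 2` coordination payoff with gain `α`: coordinating on `x` pays `1 + α`,
coordinating on `y` pays `1`, miscoordinating pays `0`. -/
def payoff (α : ℝ) : Choice → Choice → ℝ
  | Choice.x, Choice.x => 1 + α
  | Choice.y, Choice.y => 1
  | _, _ => 0

open Classical in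
/-- The benefit of agent `i` at the profile `a`: the sum of the payoffs (with gain `α`) from the
interactions with all neighbours of `i` in `G`. -/
noncomputable def benefit (G : SimpleGraph V) (α : ℝ) (i : V) (a : V → Choice) : ℝ :=
  ∑ j ∈ G.neighborFinset i, payoff α (a i) (a j)

/-- The welfare of a profile: the sum of the benefits of all agents. -/
noncomputable def welfare (G : SimpleGraph V) (α : ℝ) (a : V → Choice) : ℝ :=
  ∑ i, benefit G α i a

/-! ### Log-linear learning

`A i` is the (nonempty) action set of agent `i`, and `U i a` the utility of agent `i` at the
profile `a`. The profiles of the game are the elements of `Fintype.piFinset A`. -/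

/-- The probability with which agent `i`, when selected to revise at the profile `a`, switches to
the action `z`, if the rationality parameter is `β`. -/
noncomputable def logitProb (A : V → Finset Choice) (U : V → (V → Choice) → ℝ) (β : ℝ)
    (a : V → Choice) (i : V) (z : Choice) : ℝ :=
  Real.exp (β * U i (Function.update a i z)) /
    ∑ z' ∈ A i, Real.exp (β * U i (Function.update a i z'))

/-- The one-step transition probability from `a` to `b`: an agent `i` is selected uniformly at
random and revises its action, and all other agents repeat their previous actions. -/
noncomputable def transition (A : V → Finset Choice) (U : V → (V → Choice) → ℝ) (β : ℝ)
    (a b : V → Choice) : ℝ :=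
  ∑ i, (Fintype.card V : ℝ)⁻¹ *
    ∑ z ∈ A i, if Function.update a i z = b then logitProb A U β a i z else 0

/-- `p` is a stationary distribution, on the set of profiles `Fintype.piFinset A`, of log-linear
learning with rationality parameter `β`. -/
structure IsStationary (A : V → Finset Choice) (U : V → (V → Choice) → ℝ) (β : ℝ)
    (p : (V → Choice) → ℝ) : Prop where
  nonneg : ∀ a, 0 ≤ p a
  supported : ∀ a, a ∉ Fintype.piFinset A → p a = 0
  sum_eq_one : ∑ a ∈ Fintype.piFinset A, p a = 1
  invariant : ∀ b ∈ Fintype.piFinset A,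
    ∑ a ∈ Fintype.piFinset A, p a * transition A U β a b = p b

/-- The stochastically stable states of log-linear learning: the profiles to which the stationary
distributions `p β` give positive probability in the limit `β → ∞`. (The chain is irreducible on the
finite set of profiles, so for each `β > 0` there is exactly one stationary distribution.) -/
def stochasticallyStable (A : V → Finset Choice) (U : V → (V → Choice) → ℝ) :
    Set (V → Choice) :=
  {a | a ∈ Fintype.piFinset A ∧
    ∃ p : ℝ → (V → Choice) → ℝ, (∀ β, 0 < β → IsStationary A U β (p β)) ∧
      ∃ l : ℝ, 0 < l ∧ Tendsto (fun β => p β a) atTop (𝓝 l)}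

/-- Efficiency: the least welfare over the stochastically stable states, divided by the greatest
welfare over all profiles. Welfare is measured with the true gain `αsys`; the dynamics is run with
the utilities `U`. -/
noncomputable def efficiency (G : SimpleGraph V) (αsys : ℝ) (A : V → Finset Choice)
    (U : V → (V → Choice) → ℝ) : ℝ :=
  sInf (welfare G αsys '' stochasticallyStable A U) /
    sSup (welfare G αsys '' {a | a ∈ Fintype.piFinset A})

end Game

/-! ### Broad attacks -/

/-- A target set: each agent gets exactly one imposter, either an `x`-imposter or a
`y`-imposter. -/
structure TargetSet (V : Type*) [Fintype V] [DecidableEq V] where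
  sx : Finset V
  sy : Finset V
  disj : Disjoint sx sy
  cover : sx ∪ sy = Finset.univ

/-- The utility with gain `α` perceived by agent `i` when its imposter counts as an additional
neighbour. -/
noncomputable def perceivedUtility {V : Type*} [Fintype V] [DecidableEq V] (G : SimpleGraph V)
    (α : ℝ) (S : TargetSet V) (i : V) (a : V → Choice) : ℝ :=
  benefit G α i a + (if i ∈ S.sy ∧ a i = Choice.y then 1 else 0)
    + (if i ∈ S.sx ∧ a i = Choice.x then 1 + α else 0)

/-- The risk `R_b(α, S; G)`. -/
noncomputable def broadRisk {V : Type*} [Fintype V] [DecidableEq V] (αsys α : ℝ)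
    (G : SimpleGraph V) (S : TargetSet V) : ℝ :=
  1 - efficiency G αsys (fun _ => Finset.univ) (perceivedUtility G α S)

/-- The worst-case broad risk `R_b^*(α)`: the supremum of the risk over all connected graphs on
`N ≥ 3` nodes and all target sets. (All these risks lie in `[0, 1]`.) -/
noncomputable def worstBroadRisk (αsys α : ℝ) : ℝ :=
  sSup {r : ℝ | ∃ N : ℕ, 3 ≤ N ∧ ∃ G : SimpleGraph (Fin N), G.Connected ∧
    ∃ S : TargetSet (Fin N), r = broadRisk αsys α G S}

/-! ### Focused attacks -/

/-- A fixed set: a nonempty strict subset of the agents, split into the agents fixed at `x` and the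
agents fixed at `y`. -/
structure FixedSet (V : Type*) [Fintype V] [DecidableEq V] where
  fx : Finset V
  fy : Finset V
  disj : Disjoint fx fy
  nonempty : (fx ∪ fy).Nonempty
  strict : fx ∪ fy ⊂ Finset.univ

/-- The action sets restricted by a fixed set. -/
def FixedSet.actions {V : Type*} [Fintype V] [DecidableEq V] (F : FixedSet V) (i : V) :
    Finset Choice :=
  if i ∈ F.fx then {Choice.x} else if i ∈ F.fy then {Choice.y} else Finset.univ

/-- The risk `R_f(α, F; G)`. -/
noncomputable def focusedRisk {V : Type*} [Fintype V] [DecidableEq V] (αsys α : ℝ)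
    (G : SimpleGraph V) (F : FixedSet V) : ℝ :=
  1 - efficiency G αsys F.actions (benefit G α)

/-- The worst-case focused risk `R_f^*(α)`: the supremum of the risk over all connected graphs on
`N ≥ 3` nodes and all fixed sets. (All these risks lie in `[0, 1]`.) -/
noncomputable def worstFocusedRisk (αsys α : ℝ) : ℝ :=
  sSup {r : ℝ | ∃ N : ℕ, 3 ≤ N ∧ ∃ G : SimpleGraph (Fin N), G.Connected ∧
    ∃ F : FixedSet (Fin N), r = focusedRisk αsys α G F}

end CoordGame

set_option linter.unusedSectionVars false

/-! The gain enters twice. A bound on the focused risk caps it, `α ≤ (1 + αsys) / (1 - γf) - 1`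
(`gain_le_of_worstFocusedRisk_le`), and the worst broad risk is antitone in positive gains
(`worstBroadRisk_antitone`).

In both games log-linear learning is reversible for the Gibbs measure of an exact potential: half
the welfare at gain `α`, plus the imposter terms under a broad attack. The stable profiles are
therefore the maximizers of the potential (`mem_stochasticallyStable_iff`).

For the cap, take a star with free centre, `p` leaves fixed at `x` and about `(1 + α) p` at `y`. The
centre stably plays `x` although `y` may be better for the true gain, and the risk tends to `1 - (1
+ αsys) / (1 + α)` as `p` grows.

For antitonicity, the risks possible at the larger gain are bounded by risks that stars attain at
the smaller one. A stable all-`y` profile forces gain at most `3/2`, where the three-agent star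
already has all `y` stable. In a stable mixed profile, let a component of the `y`-agents have `e`
internal edges and `c ≥ 1` edges to `x`-agents. Stability and connectedness give `α e + (1 + α) c ≤
e + 1`, hence `α < 1` and `e ≥ m c` with `m = ⌈α / (1 - α)⌉`. So miscoordinated edges are at most a
fraction `1 / (m + 1)` of all edges, exactly as in a star with `m` edges `y`-`y` and one
miscoordinated edge; that star profile stays stable for smaller gains. -/

namespace CoordGame


/-! ### Stochastic stability in potential games -/

section Potential

variable {V : Type*} [Fintype V] [DecidableEq V]

/-- `Φ` is an exact potential for the utilities `U`. -/
def IsPotential (U : V → (V → Choice) → ℝ) (Φ : (V → Choice) → ℝ) : Prop :=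
  ∀ a i z z', U i (Function.update a i z) - U i (Function.update a i z') =
    Φ (Function.update a i z) - Φ (Function.update a i z')

variable {A : V → Finset Choice} {U : V → (V → Choice) → ℝ} {Φ : (V → Choice) → ℝ} {β : ℝ}

/-- Over the revisions of one agent, `U i` and `Φ` differ by a constant, which cancels in the
quotient. -/
theorem logitProb_eq_of_isPotential (hΦ : IsPotential U Φ) (a : V → Choice) (i : V) (z : Choice) :
    logitProb A U β a i z = Real.exp (β * Φ (Function.update a i z)) /
      ∑ z' ∈ A i, Real.exp (β * Φ (Function.update a i z')) := by
  unfold logitProb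
  set k := U i (Function.update a i z) - Φ (Function.update a i z) with hk
  have key : ∀ z', Real.exp (β * U i (Function.update a i z')) =
      Real.exp (β * Φ (Function.update a i z')) * Real.exp (β * k) := by
    intro z'
    rw [← Real.exp_add]
    have := hΦ a i z z'
    congr 1
    rw [← mul_add]
    congr 1
    linarith
  simp_rw [key]
  rw [← Finset.sum_mul, mul_div_mul_right _ _ (Real.exp_ne_zero _)]

theorem logitProb_pos {a : V → Choice} {i : V} (h : (A i).Nonempty) (z : Choice) :
    0 < logitProb A U β a i z :=
  div_pos (Real.exp_pos _) (Finset.sum_pos (fun _ _ => Real.exp_pos _) h)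

theorem sum_logitProb {a : V → Choice} {i : V} (h : (A i).Nonempty) :
    ∑ z ∈ A i, logitProb A U β a i z = 1 := by
  unfold logitProb
  rw [← Finset.sum_div]
  exact div_self (Finset.sum_pos (fun _ _ => Real.exp_pos _) h).ne'

theorem sum_ite_update {a b : V → Choice} {i : V} (hb : b i ∈ A i) (f : Choice → ℝ) :
    (∑ z ∈ A i, if Function.update a i z = b then f z else 0) =
      if Function.update a i (b i) = b then f (b i) else 0 := by
  rw [Finset.sum_eq_single (b i)]
  · intro z _ hz
    rw [if_neg]
    rintro rfl
    simp at hz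
  · exact fun h => absurd hb h

theorem update_eq_iff_update_eq {a b : V → Choice} {i : V} :
    Function.update a i (b i) = b ↔ Function.update b i (a i) = a := by
  constructor <;> intro h <;> rw [← h] <;> simp

/-- Detailed balance: when one revision by `i` links the two profiles, both directions have the same
normalizing sum. -/
theorem transition_balance (hΦ : IsPotential U Φ) {a b : V → Choice}
    (ha : a ∈ Fintype.piFinset A) (hb : b ∈ Fintype.piFinset A) :
    Real.exp (β * Φ a) * transition A U β a b = Real.exp (β * Φ b) * transition A U β b a := by
  rw [Fintype.mem_piFinset] at ha hb
  unfold transition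
  rw [Finset.mul_sum, Finset.mul_sum]
  refine Finset.sum_congr rfl fun i _ => ?_
  rw [sum_ite_update (hb i), sum_ite_update (ha i)]
  by_cases h : Function.update a i (b i) = b
  · have h' := update_eq_iff_update_eq.1 h
    rw [if_pos h, if_pos h', logitProb_eq_of_isPotential hΦ, logitProb_eq_of_isPotential hΦ, h, h']
    have : ∀ z, Function.update b i z = Function.update a i z := by
      intro z
      rw [← h]
      simp
    simp_rw [this]
    ring
  · have h' : ¬ Function.update b i (a i) = a := fun h' => h (update_eq_iff_update_eq.2 h')
    rw [if_neg h, if_neg h']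
    simp

theorem update_mem_piFinset {a : V → Choice} (ha : a ∈ Fintype.piFinset A) {i : V} {z : Choice}
    (hz : z ∈ A i) : Function.update a i z ∈ Fintype.piFinset A := by
  rw [Fintype.mem_piFinset] at ha ⊢
  intro j
  by_cases h : j = i
  · subst h; simpa using hz
  · simpa [h] using ha j

theorem sum_transition [Nonempty V] {a : V → Choice} (ha : a ∈ Fintype.piFinset A) :
    ∑ b ∈ Fintype.piFinset A, transition A U β a b = 1 := by
  unfold transition
  rw [Finset.sum_comm]
  have : ∀ i : V, (∑ b ∈ Fintype.piFinset A, (Fintype.card V : ℝ)⁻¹ *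
      ∑ z ∈ A i, if Function.update a i z = b then logitProb A U β a i z else 0) =
      (Fintype.card V : ℝ)⁻¹ := by
    intro i
    have hi : (A i).Nonempty := ⟨a i, Fintype.mem_piFinset.1 ha i⟩
    rw [← Finset.mul_sum, Finset.sum_comm]
    rw [Finset.sum_congr rfl (g := fun z => logitProb A U β a i z), sum_logitProb hi, mul_one]
    intro z hz
    rw [Finset.sum_ite_eq, if_pos (update_mem_piFinset ha hz)]
  simp_rw [this]
  simp

theorem transition_nonneg {a b : V → Choice} (ha : a ∈ Fintype.piFinset A) :
    0 ≤ transition A U β a b := by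
  unfold transition
  refine Finset.sum_nonneg fun i _ => mul_nonneg (by positivity) (Finset.sum_nonneg fun z _ => ?_)
  split_ifs
  · exact (logitProb_pos ⟨a i, Fintype.mem_piFinset.1 ha i⟩ z).le
  · exact le_rfl

theorem transition_update_pos {a : V → Choice} (ha : a ∈ Fintype.piFinset A) {i : V} {z : Choice}
    (hz : z ∈ A i) : 0 < transition A U β a (Function.update a i z) := by
  have hne : ∀ j, (A j).Nonempty := fun j => ⟨a j, Fintype.mem_piFinset.1 ha j⟩
  have hcard : (0 : ℝ) < (Fintype.card V : ℝ)⁻¹ := by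
    have : 0 < Fintype.card V := Fintype.card_pos_iff.2 ⟨i⟩
    positivity
  unfold transition
  refine Finset.sum_pos' (fun j _ => mul_nonneg hcard.le (Finset.sum_nonneg fun w _ => ?_))
    ⟨i, Finset.mem_univ i, mul_pos hcard (Finset.sum_pos' (fun w _ => ?_) ⟨z, hz, ?_⟩)⟩
  · split_ifs
    · exact (logitProb_pos (hne j) w).le
    · exact le_rfl
  · split_ifs
    · exact (logitProb_pos (hne i) w).le
    · exact le_rfl
  · rw [if_pos rfl]
    exact logitProb_pos (hne i) z

/-- The Gibbs distribution of the potential `Φ` on the profiles of the game. -/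
noncomputable def gibbs (A : V → Finset Choice) (Φ : (V → Choice) → ℝ) (β : ℝ)
    (a : V → Choice) : ℝ :=
  if a ∈ Fintype.piFinset A then
    Real.exp (β * Φ a) / ∑ b ∈ Fintype.piFinset A, Real.exp (β * Φ b) else 0

theorem isStationary_gibbs [Nonempty V] (hA : (Fintype.piFinset A).Nonempty)
    (hΦ : IsPotential U Φ) : IsStationary A U β (gibbs A Φ β) := by
  have hZ : 0 < ∑ b ∈ Fintype.piFinset A, Real.exp (β * Φ b) :=
    Finset.sum_pos (fun _ _ => Real.exp_pos _) hA
  refine ⟨fun a => ?_, fun a ha => if_neg ha, ?_, fun b hb => ?_⟩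
  · unfold gibbs
    split_ifs
    · positivity
    · exact le_rfl
  · unfold gibbs
    rw [Finset.sum_congr rfl (fun a ha => if_pos ha), ← Finset.sum_div]
    exact div_self hZ.ne'
  · have : ∀ a ∈ Fintype.piFinset A, gibbs A Φ β a * transition A U β a b =
        gibbs A Φ β b * transition A U β b a := by
      intro a ha
      unfold gibbs
      rw [if_pos ha, if_pos hb, div_mul_eq_mul_div, div_mul_eq_mul_div,
        transition_balance hΦ ha hb]
    rw [Finset.sum_congr rfl this, ← Finset.mul_sum, sum_transition hb, mul_one]

/-- A property that holds at one profile and is preserved by every revision holds at all profiles. -/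
theorem eq_of_forall_update {P : (V → Choice) → Prop} {a : V → Choice}
    (ha : a ∈ Fintype.piFinset A) (hPa : P a)
    (hP : ∀ c ∈ Fintype.piFinset A, P c → ∀ i, ∀ z ∈ A i, P (Function.update c i z))
    {b : V → Choice} (hb : b ∈ Fintype.piFinset A) : P b := by
  -- Move from `a` to `b` one coordinate at a time; every intermediate profile is admissible.
  have key : ∀ s : Finset V, (s.piecewise b a ∈ Fintype.piFinset A) ∧ P (s.piecewise b a) := by
    intro s
    induction s using Finset.induction_on with
    | empty => simpa using ⟨Fintype.mem_piFinset.1 ha, hPa⟩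
    | insert i s _ ih =>
      rw [Finset.piecewise_insert]
      have hbi := Fintype.mem_piFinset.1 hb i
      exact ⟨update_mem_piFinset ih.1 hbi, hP _ ih.1 ih.2 i _ hbi⟩
  simpa using (key Finset.univ).2

/-- Uniqueness by the maximum principle: by reversibility the density of `p` relative to `exp (β *
Φ)` is harmonic, so its maximum propagates along revisions and the density is constant. -/
theorem IsStationary.eq_gibbs [Nonempty V] (hA : (Fintype.piFinset A).Nonempty)
    (hΦ : IsPotential U Φ) {p : (V → Choice) → ℝ} (hp : IsStationary A U β p)
    {a : V → Choice} (ha : a ∈ Fintype.piFinset A) : p a = gibbs A Φ β a := by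
  set h : (V → Choice) → ℝ := fun a => p a / Real.exp (β * Φ a) with hh
  have hph : ∀ a, p a = Real.exp (β * Φ a) * h a := fun a => by
    rw [hh]; field_simp
  have hharm : ∀ b ∈ Fintype.piFinset A,
      ∑ c ∈ Fintype.piFinset A, transition A U β b c * h c = h b := by
    intro b hb
    have h1 := hp.invariant b hb
    have h2 : ∀ c ∈ Fintype.piFinset A, p c * transition A U β c b =
        Real.exp (β * Φ b) * (transition A U β b c * h c) := by
      intro c hc
      rw [hph c, mul_right_comm, transition_balance hΦ hc hb, mul_assoc]
    rw [Finset.sum_congr rfl h2, ← Finset.mul_sum, hph b] at h1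
    exact mul_left_cancel₀ (Real.exp_ne_zero _) h1
  obtain ⟨m, hm, hmax⟩ := Finset.exists_max_image (Fintype.piFinset A) h hA
  have hconst : ∀ b ∈ Fintype.piFinset A, h b = h m := by
    intro b hb
    refine eq_of_forall_update (P := fun b => h b = h m) hm rfl ?_ hb
    intro c hc hcm i z hz
    by_contra hne
    have hu := update_mem_piFinset hc hz
    have hlt : h (Function.update c i z) < h m := lt_of_le_of_ne (hmax _ hu) hne
    have h3 : ∑ d ∈ Fintype.piFinset A, transition A U β c d * h d <
        ∑ d ∈ Fintype.piFinset A, transition A U β c d * h m :=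
      Finset.sum_lt_sum (fun d hd => mul_le_mul_of_nonneg_left (hmax d hd) (transition_nonneg hc))
        ⟨_, hu, mul_lt_mul_of_pos_left hlt (transition_update_pos hc hz)⟩
    rw [hharm c hc, ← Finset.sum_mul, sum_transition hc, one_mul, hcm] at h3
    exact lt_irrefl _ h3
  have hsum := hp.sum_eq_one
  have hZ : 0 < ∑ b ∈ Fintype.piFinset A, Real.exp (β * Φ b) :=
    Finset.sum_pos (fun _ _ => Real.exp_pos _) hA
  rw [Finset.sum_congr rfl (fun b hb => by rw [hph b, hconst b hb]), ← Finset.sum_mul] at hsum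
  unfold gibbs
  rw [if_pos ha, hph a, hconst a ha, eq_div_iff hZ.ne', mul_assoc, mul_comm (h m), hsum, mul_one]

theorem tendsto_exp_mul_of_neg {c : ℝ} (hc : c < 0) :
    Tendsto (fun β : ℝ => Real.exp (β * c)) atTop (𝓝 0) :=
  Real.tendsto_exp_atBot.comp (tendsto_id.atTop_mul_const_of_neg hc)

/-- In a potential game the stochastically stable states are the maximizers of the potential. -/
theorem mem_stochasticallyStable_iff [Nonempty V] (hΦ : IsPotential U Φ) {a : V → Choice} :
    a ∈ stochasticallyStable A U ↔
      a ∈ Fintype.piFinset A ∧ ∀ b ∈ Fintype.piFinset A, Φ b ≤ Φ a := by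
  refine and_congr_right fun ha => ?_
  have hA : (Fintype.piFinset A).Nonempty := ⟨a, ha⟩
  constructor
  · rintro ⟨p, hp, l, hl, hlim⟩ b hb
    by_contra! hlt
    have hle : ∀ᶠ β : ℝ in atTop, p β a ≤ Real.exp (β * (Φ a - Φ b)) := by
      filter_upwards [eventually_gt_atTop 0] with β hβ
      rw [(hp β hβ).eq_gibbs hA hΦ ha]
      unfold gibbs
      rw [if_pos ha, mul_sub, Real.exp_sub]
      refine div_le_div_of_nonneg_left (Real.exp_pos _).le (Real.exp_pos _) ?_
      exact Finset.single_le_sum (f := fun b => Real.exp (β * Φ b))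
        (fun _ _ => (Real.exp_pos _).le) hb
    have := le_of_tendsto_of_tendsto hlim (tendsto_exp_mul_of_neg (sub_neg.2 hlt)) hle
    linarith
  · intro hmax
    refine ⟨fun β => gibbs A Φ β, fun β _ => isStationary_gibbs hA hΦ, ?_⟩
    -- `K` counts the maximizers; the Gibbs measure becomes uniform on them.
    set K : ℝ := ∑ b ∈ Fintype.piFinset A, if Φ b = Φ a then 1 else 0 with hK
    have hKpos : 0 < K := by
      refine Finset.sum_pos' (fun b _ => ?_) ⟨a, ha, by simp⟩
      split_ifs <;> norm_num
    refine ⟨K⁻¹, inv_pos.2 hKpos, ?_⟩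
    have heq : (fun β => gibbs A Φ β a) = fun β : ℝ =>
        (∑ b ∈ Fintype.piFinset A, Real.exp (β * (Φ b - Φ a)))⁻¹ := by
      funext β
      unfold gibbs
      rw [if_pos ha, ← inv_div, Finset.sum_div]
      simp_rw [mul_sub, Real.exp_sub]
    rw [heq]
    refine Tendsto.inv₀ (tendsto_finsetSum _ fun b hb => ?_) hKpos.ne'
    split_ifs with h
    · simp [h]
    · exact tendsto_exp_mul_of_neg (sub_neg.2 (lt_of_le_of_ne (hmax b hb) h))

theorem stochasticallyStable_nonempty [Nonempty V] (hA : (Fintype.piFinset A).Nonempty)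
    (hΦ : IsPotential U Φ) : (stochasticallyStable A U).Nonempty := by
  obtain ⟨a, ha, hmax⟩ := Finset.exists_max_image (Fintype.piFinset A) Φ hA
  exact ⟨a, (mem_stochasticallyStable_iff hΦ).2 ⟨ha, hmax⟩⟩

end Potential

/-! ### Welfare as a potential -/

section Welfare

variable {V : Type*} [Fintype V] [DecidableEq V] (G : SimpleGraph V)

open Classical in
/-- The adjacency indicator of a graph. -/
noncomputable def adjWeight (i j : V) : ℝ := if G.Adj i j then 1 else 0

theorem adjWeight_comm (i j : V) : adjWeight G i j = adjWeight G j i := by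
  unfold adjWeight
  rw [G.adj_comm]

theorem adjWeight_self (i : V) : adjWeight G i i = 0 := by simp [adjWeight]

theorem adjWeight_nonneg (i j : V) : 0 ≤ adjWeight G i j := by
  unfold adjWeight
  split_ifs <;> norm_num

theorem payoff_comm (α : ℝ) (c d : Choice) : payoff α c d = payoff α d c := by
  cases c <;> cases d <;> rfl

theorem payoff_nonneg {α : ℝ} (hα : 0 < α) (c d : Choice) : 0 ≤ payoff α c d := by
  cases c <;> cases d <;> simp [payoff]; linarith

theorem payoff_le {α : ℝ} (hα : 0 < α) (c d : Choice) : payoff α c d ≤ 1 + α := by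
  cases c <;> cases d <;> simp [payoff] <;> linarith

theorem benefit_eq_sum (α : ℝ) (i : V) (a : V → Choice) :
    benefit G α i a = ∑ j, adjWeight G i j * payoff α (a i) (a j) := by
  classical
  unfold benefit adjWeight
  simp_rw [ite_mul, one_mul, zero_mul]
  rw [← Finset.sum_filter]
  congr 1
  ext j
  simp

theorem welfare_eq_sum (α : ℝ) (a : V → Choice) :
    welfare G α a = ∑ i, ∑ j, adjWeight G i j * payoff α (a i) (a j) := by
  simp only [welfare, benefit_eq_sum]

theorem welfare_nonneg {α : ℝ} (hα : 0 < α) (a : V → Choice) : 0 ≤ welfare G α a := by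
  rw [welfare_eq_sum]
  exact Finset.sum_nonneg fun i _ => Finset.sum_nonneg fun j _ =>
    mul_nonneg (adjWeight_nonneg G i j) (payoff_nonneg hα _ _)

theorem welfare_le_all_x {α : ℝ} (hα : 0 < α) (a : V → Choice) :
    welfare G α a ≤ welfare G α fun _ => Choice.x := by
  rw [welfare_eq_sum, welfare_eq_sum]
  exact Finset.sum_le_sum fun i _ => Finset.sum_le_sum fun j _ =>
    mul_le_mul_of_nonneg_left (payoff_le hα _ _) (adjWeight_nonneg G i j)

/-- Each edge at `i` is counted from both ends, and the remaining sum ignores the action of `i`.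
This is why half the welfare is a potential. -/
theorem welfare_eq_two_mul_benefit_add (α : ℝ) (i : V) (a : V → Choice) :
    welfare G α a = 2 * benefit G α i a + ∑ j ∈ Finset.univ.erase i, ∑ k ∈ Finset.univ.erase i,
      adjWeight G j k * payoff α (a j) (a k) := by
  have hb : benefit G α i a =
      ∑ j ∈ Finset.univ.erase i, adjWeight G i j * payoff α (a i) (a j) := by
    rw [benefit_eq_sum, ← Finset.add_sum_erase _ _ (Finset.mem_univ i), adjWeight_self]
    simp
  have hb' : benefit G α i a =
      ∑ j ∈ Finset.univ.erase i, adjWeight G j i * payoff α (a j) (a i) := by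
    rw [hb]
    exact Finset.sum_congr rfl fun j _ => by rw [adjWeight_comm, payoff_comm]
  rw [welfare_eq_sum, ← Finset.add_sum_erase _ _ (Finset.mem_univ i), ← benefit_eq_sum,
    Finset.sum_congr rfl fun j _ => (Finset.add_sum_erase _ _ (Finset.mem_univ i)).symm,
    Finset.sum_add_distrib, ← hb']
  ring

theorem isPotential_benefit (α : ℝ) :
    IsPotential (benefit G α) (fun a => welfare G α a / 2) := by
  intro a i z z'
  have h : ∀ w, (∑ j ∈ Finset.univ.erase i, ∑ k ∈ Finset.univ.erase i, adjWeight G j k *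
      payoff α (Function.update a i w j) (Function.update a i w k)) =
      ∑ j ∈ Finset.univ.erase i, ∑ k ∈ Finset.univ.erase i, adjWeight G j k *
        payoff α (a j) (a k) := by
    intro w
    refine Finset.sum_congr rfl fun j hj => Finset.sum_congr rfl fun k hk => ?_
    rw [Function.update_of_ne (Finset.ne_of_mem_erase hj),
      Function.update_of_ne (Finset.ne_of_mem_erase hk)]
  beta_reduce
  rw [welfare_eq_two_mul_benefit_add G α i, welfare_eq_two_mul_benefit_add G α i, h, h]
  ring

/-- The part of the perceived utility of agent `i` that is due to its imposter. -/
noncomputable def imposterTerm (α : ℝ) (S : TargetSet V) (i : V) (c : Choice) : ℝ :=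
  (if i ∈ S.sy ∧ c = Choice.y then 1 else 0) + (if i ∈ S.sx ∧ c = Choice.x then 1 + α else 0)

theorem perceivedUtility_eq (α : ℝ) (S : TargetSet V) (i : V) (a : V → Choice) :
    perceivedUtility G α S i a = benefit G α i a + imposterTerm α S i (a i) := by
  rw [perceivedUtility, imposterTerm, add_assoc]

/-- The potential of the game under a broad attack. -/
noncomputable def broadPotential (α : ℝ) (S : TargetSet V) (a : V → Choice) : ℝ :=
  welfare G α a / 2 + ∑ i, imposterTerm α S i (a i)

theorem isPotential_perceivedUtility (α : ℝ) (S : TargetSet V) :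
    IsPotential (perceivedUtility G α S) (broadPotential G α S) := by
  intro a i z z'
  have h : ∀ w, ∑ j, imposterTerm α S j (Function.update a i w j) =
      imposterTerm α S i w + ∑ j ∈ Finset.univ.erase i, imposterTerm α S j (a j) := by
    intro w
    rw [← Finset.add_sum_erase _ _ (Finset.mem_univ i), Function.update_self]
    congr 1
    refine Finset.sum_congr rfl fun j hj => ?_
    rw [Function.update_of_ne (Finset.ne_of_mem_erase hj)]
  have hb := isPotential_benefit G α a i z z'
  beta_reduce at hb
  rw [perceivedUtility_eq, perceivedUtility_eq, broadPotential, broadPotential, h, h,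
    Function.update_self, Function.update_self]
  linarith

/-! ### Bounds on the risk -/

theorem efficiency_nonneg {αsys : ℝ} (hsys : 0 < αsys) (A : V → Finset Choice)
    (U : V → (V → Choice) → ℝ) : 0 ≤ efficiency G αsys A U := by
  refine div_nonneg (Real.sInf_nonneg ?_) (Real.sSup_nonneg ?_) <;>
  · rintro _ ⟨a, _, rfl⟩
    exact welfare_nonneg G hsys a

theorem efficiency_le {αsys : ℝ} (hsys : 0 < αsys) {A : V → Finset Choice}
    {U : V → (V → Choice) → ℝ} {a b : V → Choice} (ha : a ∈ stochasticallyStable A U)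
    (hb : b ∈ Fintype.piFinset A) (hpos : 0 < welfare G αsys b) :
    efficiency G αsys A U ≤ welfare G αsys a / welfare G αsys b := by
  have h1 : sInf (welfare G αsys '' stochasticallyStable A U) ≤ welfare G αsys a :=
    csInf_le (Set.Finite.bddBelow ((Set.toFinite _).image _)) ⟨a, ha, rfl⟩
  have h2 : welfare G αsys b ≤ sSup (welfare G αsys '' {a | a ∈ Fintype.piFinset A}) :=
    le_csSup (Set.Finite.bddAbove ((Set.toFinite _).image _)) ⟨b, hb, rfl⟩
  exact div_le_div₀ (welfare_nonneg G hsys a) h1 hpos h2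

/-- Maximal welfare is attained at all `x`, so the risk is controlled by the welfare of the
maximizers of the potential. -/
theorem broadRisk_le [Nonempty V] {αsys α r : ℝ} (hsys : 0 < αsys) (S : TargetSet V)
    (hpos : 0 < welfare G αsys fun _ => Choice.x)
    (h : ∀ a, (∀ b, broadPotential G α S b ≤ broadPotential G α S a) →
      (1 - r) * welfare G αsys (fun _ => Choice.x) ≤ welfare G αsys a) :
    broadRisk αsys α G S ≤ r := by
  have hpot := isPotential_perceivedUtility G α S
  have hsup : sSup (welfare G αsys '' {a | a ∈ Fintype.piFinset fun _ : V =>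
      (Finset.univ : Finset Choice)}) = welfare G αsys fun _ => Choice.x := by
    refine IsGreatest.csSup_eq ⟨⟨_, by simp, rfl⟩, ?_⟩
    rintro _ ⟨a, _, rfl⟩
    exact welfare_le_all_x G hsys a
  have hinf : (1 - r) * welfare G αsys (fun _ => Choice.x) ≤
      sInf (welfare G αsys '' stochasticallyStable (fun _ => Finset.univ)
        (perceivedUtility G α S)) := by
    refine le_csInf ((stochasticallyStable_nonempty ?_ hpot).image _) ?_
    · exact ⟨fun _ => Choice.x, by simp⟩
    · rintro _ ⟨a, ha, rfl⟩
      exact h a fun b => ((mem_stochasticallyStable_iff hpot).1 ha).2 b (by simp)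
  unfold broadRisk efficiency
  rw [hsup]
  have := (le_div_iff₀ hpos).2 hinf
  linarith

end Welfare

/-- Boundedness is what makes the risk of a single star a lower bound for the real supremum. -/
theorem bddAbove_broadRisk {αsys : ℝ} (hsys : 0 < αsys) (α : ℝ) :
    BddAbove {r : ℝ | ∃ N : ℕ, 3 ≤ N ∧ ∃ G : SimpleGraph (Fin N), G.Connected ∧
      ∃ S : TargetSet (Fin N), r = broadRisk αsys α G S} := by
  refine ⟨1, ?_⟩
  rintro _ ⟨N, _, G, _, S, rfl⟩
  have := efficiency_nonneg G hsys (fun _ => Finset.univ) (perceivedUtility G α S)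
  unfold broadRisk
  linarith

theorem bddAbove_focusedRisk {αsys : ℝ} (hsys : 0 < αsys) (α : ℝ) :
    BddAbove {r : ℝ | ∃ N : ℕ, 3 ≤ N ∧ ∃ G : SimpleGraph (Fin N), G.Connected ∧
      ∃ F : FixedSet (Fin N), r = focusedRisk αsys α G F} := by
  refine ⟨1, ?_⟩
  rintro _ ⟨N, _, G, _, F, rfl⟩
  have := efficiency_nonneg G hsys F.actions (benefit G α)
  unfold focusedRisk
  linarith


/-! ### Attacks on stars -/

section Star

open SimpleGraph

theorem connected_star (n : ℕ) : (starGraph (0 : Fin (n + 1))).Connected :=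
  (isTree_starGraph (r := (0 : Fin (n + 1)))).1

theorem welfare_star (n : ℕ) (α : ℝ) (a : Fin (n + 1) → Choice) :
    welfare (starGraph (0 : Fin (n + 1))) α a = 2 * ∑ j : Fin n, payoff α (a 0) (a j.succ) := by
  have h0 : ∀ j : Fin n, adjWeight (starGraph (0 : Fin (n + 1))) 0 j.succ = 1 := fun j => by
    simp [adjWeight, (Fin.succ_ne_zero j).symm]
  have h1 : ∀ j : Fin n, adjWeight (starGraph (0 : Fin (n + 1))) j.succ 0 = 1 := fun j => by
    simp [adjWeight]
  have h2 : ∀ j k : Fin n, adjWeight (starGraph (0 : Fin (n + 1))) j.succ k.succ = 0 :=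
    fun j k => by simp [adjWeight]
  rw [welfare_eq_sum, Fin.sum_univ_succ]
  simp_rw [Fin.sum_univ_succ, h0, h1, h2, adjWeight_self]
  simp_rw [payoff_comm α (a (Fin.succ _)) (a 0)]
  simp
  ring

/-- The profile of a star in which the first `p` leaves play `x` and the other leaves play `y`. -/
def starProfile (n p : ℕ) (c : Choice) : Fin (n + 1) → Choice :=
  Fin.cases c fun j : Fin n => if (j : ℕ) < p then Choice.x else Choice.y

theorem welfare_starProfile (p q : ℕ) (α : ℝ) (c : Choice) :
    welfare (starGraph (0 : Fin (p + q + 1))) α (starProfile (p + q) p c) =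
      2 * (p * payoff α c Choice.x + q * payoff α c Choice.y) := by
  rw [welfare_star, Fin.sum_univ_add]
  simp [starProfile]

/-- Fixing the first `p` leaves at `x` and the other leaves at `y`. -/
def starFixedSet (n p : ℕ) (hn : 0 < n) : FixedSet (Fin (n + 1)) where
  fx := Finset.univ.filter fun i => i ≠ 0 ∧ starProfile n p Choice.x i = Choice.x
  fy := Finset.univ.filter fun i => i ≠ 0 ∧ starProfile n p Choice.x i = Choice.y
  disj := by
    rw [Finset.disjoint_filter]
    rintro i _ ⟨_, h⟩ ⟨_, h'⟩
    simp [h] at h'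
  nonempty := by
    have h1 : (⟨1, by omega⟩ : Fin (n + 1)) ≠ 0 := by simp [Fin.ext_iff]
    refine ⟨⟨1, by omega⟩, ?_⟩
    cases h : starProfile n p Choice.x ⟨1, by omega⟩ <;> simp [h1, h]
  strict := by
    rw [Finset.ssubset_univ_iff]
    intro h
    have := Finset.mem_univ (0 : Fin (n + 1))
    rw [← h] at this
    simp at this

theorem mem_starFixedSet_actions {n p : ℕ} (hn : 0 < n) {a : Fin (n + 1) → Choice} :
    a ∈ Fintype.piFinset (starFixedSet n p hn).actions ↔ a = starProfile n p (a 0) := by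
  rw [Fintype.mem_piFinset]
  have hsucc : ∀ (c : Choice) (j : Fin n), starProfile n p c j.succ =
      if (j : ℕ) < p then Choice.x else Choice.y := fun c j => rfl
  constructor
  · intro h
    funext i
    refine Fin.cases rfl (fun j => ?_) i
    have hj := h j.succ
    rw [hsucc]
    by_cases hjp : (j : ℕ) < p <;>
      simpa [FixedSet.actions, starFixedSet, hsucc, hjp] using hj
  · intro h i
    refine Fin.cases ?_ (fun j => ?_) i
    · simp [FixedSet.actions, starFixedSet]
    · rw [h, hsucc]
      by_cases hjp : (j : ℕ) < p <;> simp [FixedSet.actions, starFixedSet, hsucc, hjp]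

/-- Only the centre is free, and the hypothesis `h` says that `x` is a best reply for it. The risk
is bounded below by comparison with the centre playing `y`. -/
theorem le_worstFocusedRisk {αsys α : ℝ} (hsys : 0 < αsys) {p q : ℕ}
    (hpq : 2 ≤ p + q) (hq : 0 < q) (h : (q : ℝ) ≤ (1 + α) * p) :
    1 - (1 + αsys) * p / q ≤ worstFocusedRisk αsys α := by
  have hn : 0 < p + q := by omega
  have hq' : (0 : ℝ) < q := by exact_mod_cast hq
  refine le_trans ?_ (le_csSup (bddAbove_focusedRisk hsys α) ⟨p + q + 1, by omega,
    starGraph 0, connected_star _, starFixedSet (p + q) p hn, rfl⟩)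
  have hmem : ∀ c, starProfile (p + q) p c ∈
      Fintype.piFinset (starFixedSet (p + q) p hn).actions := fun c =>
    (mem_starFixedSet_actions hn).2 rfl
  have hstable : starProfile (p + q) p Choice.x ∈
      stochasticallyStable (starFixedSet (p + q) p hn).actions (benefit (starGraph 0) α) := by
    refine (mem_stochasticallyStable_iff (isPotential_benefit _ α)).2 ⟨hmem _, fun b hb => ?_⟩
    rw [(mem_starFixedSet_actions hn).1 hb, welfare_starProfile, welfare_starProfile]
    cases b 0 <;> simp [payoff]
    linarith
  have hpos : 0 < welfare (starGraph 0) αsys (starProfile (p + q) p Choice.y) := by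
    rw [welfare_starProfile]
    simpa [payoff] using hq
  have := efficiency_le _ hsys hstable (hmem Choice.y) hpos
  rw [welfare_starProfile, welfare_starProfile, mul_div_mul_left _ _ two_ne_zero] at this
  simp only [payoff, mul_zero, add_zero, zero_add, mul_one] at this
  unfold focusedRisk
  rw [mul_comm (1 + αsys)]
  linarith

theorem gain_le_of_worstFocusedRisk_le {αsys α γ : ℝ} (hsys : 0 < αsys) (hα : 0 < α)
    (hγ : γ < 1) (h : worstFocusedRisk αsys α ≤ γ) : α ≤ (1 + αsys) / (1 - γ) - 1 := by
  have hγ' : 0 < 1 - γ := by linarith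
  rw [le_sub_iff_add_le, le_div_iff₀ hγ']
  by_contra! hlt
  obtain ⟨k, hk⟩ := exists_nat_gt ((1 - γ) / ((α + 1) * (1 - γ) - (1 + αsys)))
  rw [div_lt_iff₀ (by linarith)] at hk
  -- `k` is chosen so that the loss from rounding `(1 + α) p` down, at most `1 - γ` after scaling,
  -- cannot compensate the assumed excess; the shift by 2 keeps the star large enough.
  set p := k + 2
  have hp : (p : ℝ) = k + 2 := by simp [p]
  have hfl : 0 ≤ (1 + α) * p := by positivity
  have hq1 : p ≤ ⌊(1 + α) * p⌋₊ := Nat.le_floor (by nlinarith [(p.cast_nonneg : (0 : ℝ) ≤ p)])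
  have hle := (le_worstFocusedRisk hsys (p := p) (q := ⌊(1 + α) * p⌋₊) (by omega) (by omega)
    (Nat.floor_le hfl)).trans h
  have hq2 := Nat.lt_floor_add_one ((1 + α) * p)
  set q := ⌊(1 + α) * p⌋₊
  have hq0 : (0 : ℝ) < q := by
    have : 0 < q := by omega
    exact_mod_cast this
  have h1 : (1 - γ) * q ≤ (1 + αsys) * p := by
    rw [← le_div_iff₀ hq0]
    linarith
  have h2 : (1 - γ) * ((1 + α) * p) < (1 - γ) * (q + 1) := mul_lt_mul_of_pos_left hq2 hγ'
  have h3 : 0 < (α + 1) * (1 - γ) - (1 + αsys) := by linarith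
  rw [hp] at h1 h2
  nlinarith

/-! ### Lower bounds for the worst broad risk from stars -/

theorem broadPotential_star (n : ℕ) (α : ℝ) (S : TargetSet (Fin (n + 1)))
    (b : Fin (n + 1) → Choice) : broadPotential (starGraph 0) α S b = imposterTerm α S 0 (b 0) +
      ∑ j : Fin n, (payoff α (b 0) (b j.succ) + imposterTerm α S j.succ (b j.succ)) := by
  rw [broadPotential, welfare_star, Fin.sum_univ_succ, Finset.sum_add_distrib]
  ring

theorem le_worstBroadRisk {αsys α : ℝ} (hsys : 0 < αsys) {n : ℕ} (hn : 2 ≤ n)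
    (S : TargetSet (Fin (n + 1))) (a : Fin (n + 1) → Choice)
    (h : ∀ b, broadPotential (starGraph 0) α S b ≤ broadPotential (starGraph 0) α S a) :
    1 - welfare (starGraph 0) αsys a / (2 * (n * (1 + αsys))) ≤ worstBroadRisk αsys α := by
  refine le_trans ?_ (le_csSup (bddAbove_broadRisk hsys α)
    ⟨n + 1, by omega, starGraph 0, connected_star n, S, rfl⟩)
  have hx : welfare (starGraph 0) αsys (fun _ : Fin (n + 1) => Choice.x) =
      2 * (n * (1 + αsys)) := by
    simp only [welfare_star, payoff, Finset.sum_const, Finset.card_univ, Fintype.card_fin,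
      nsmul_eq_mul]
  have hn' : (0 : ℝ) < n := by exact_mod_cast (by omega : 0 < n)
  have := efficiency_le (starGraph 0) hsys (A := fun _ => Finset.univ) (b := fun _ => Choice.x)
    ((mem_stochasticallyStable_iff (isPotential_perceivedUtility _ α S)).2
      ⟨by simp, fun b _ => h b⟩) (by simp) (by rw [hx]; positivity)
  rw [hx] at this
  unfold broadRisk
  linarith

/-- The target set of `x`-imposters exactly at the agents playing `x` in the profile `a`. -/
def targetSetOf {V : Type*} [Fintype V] [DecidableEq V] (a : V → Choice) : TargetSet V where
  sx := Finset.univ.filter fun i => a i = Choice.x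
  sy := Finset.univ.filter fun i => a i = Choice.y
  disj := by
    rw [Finset.disjoint_filter]
    intro i _ h h'
    simp [h] at h'
  cover := by
    ext i
    cases h : a i <;> simp [h]

theorem imposterTerm_targetSetOf {V : Type*} [Fintype V] [DecidableEq V] (α : ℝ)
    (a : V → Choice) (i : V) (c : Choice) :
    imposterTerm α (targetSetOf a) i c = if c = a i then payoff α c c else 0 := by
  cases c <;> cases h : a i <;> simp [imposterTerm, targetSetOf, payoff, h]

/-- On two edges with three `y`-imposters, all `y` has potential 5 and all `x` has `2 (1 + α)`; they
tie at `3/2`. -/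
theorem worstBroadRisk_ge_of_le_three_halves {αsys α : ℝ} (hsys : 0 < αsys)
    (h : α ≤ 3 / 2) : αsys / (1 + αsys) ≤ worstBroadRisk αsys α := by
  refine le_trans ?_ (le_worstBroadRisk hsys (α := α) le_rfl (targetSetOf fun _ => Choice.y)
    (fun _ => Choice.y) fun b => ?_)
  · have : (0 : ℝ) < 1 + αsys := by linarith
    simp [welfare_star, payoff]
    field_simp
    linarith
  · rw [broadPotential_star, broadPotential_star]
    simp only [imposterTerm_targetSetOf, Fin.sum_univ_two]
    cases b 0 <;> cases b (Fin.succ 0) <;> cases b (Fin.succ 1) <;> simp [payoff] <;> linarith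

/-- One leaf has an `x`-imposter and plays `x`, all others play `y`. The potential is `2 m + 2 + α`,
against `(m + 2) (1 + α)` at all `x`, which gives the condition `h`. -/
theorem worstBroadRisk_ge_of_mul_le {αsys α : ℝ} (hsys : 0 < αsys) (hα : 0 < α) {m : ℕ}
    (hm : 1 ≤ m) (h : α * (m + 1) ≤ m) :
    (αsys + 1 / (m + 1)) / (1 + αsys) ≤ worstBroadRisk αsys α := by
  have h0 : starProfile (m + 1) 1 Choice.y 0 = Choice.y := rfl
  have h1 : starProfile (m + 1) 1 Choice.y (Fin.succ 0) = Choice.x := rfl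
  have h2 : ∀ j : Fin m, starProfile (m + 1) 1 Choice.y j.succ.succ = Choice.y := fun _ => rfl
  refine le_trans ?_ (le_worstBroadRisk hsys (α := α) (n := m + 1) (by omega)
    (targetSetOf (starProfile (m + 1) 1 Choice.y)) (starProfile (m + 1) 1 Choice.y) fun b => ?_)
  · have : (0 : ℝ) < 1 + αsys := by linarith
    have hw : welfare (starGraph 0) αsys (starProfile (m + 1) 1 Choice.y) = 2 * m := by
      rw [welfare_star, Fin.sum_univ_succ]
      simp only [h0, h1, h2, payoff]
      simp
    rw [hw]
    push_cast
    field_simp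
    linarith
  · rw [broadPotential_star, broadPotential_star, Fin.sum_univ_succ, Fin.sum_univ_succ]
    simp only [imposterTerm_targetSetOf]
    simp only [h0, h1, h2]
    -- Given the centre's action the leaves decouple, so the `m` ordinary leaves can be bounded one
    -- by one.
    have key : ∀ (c : Choice) (t : ℝ), (∀ d, payoff α c d +
        (if d = Choice.y then payoff α d d else 0) ≤ t) → ∑ j : Fin m, (payoff α c (b j.succ.succ) +
          if b j.succ.succ = Choice.y then payoff α (b j.succ.succ) (b j.succ.succ) else 0) ≤
        m * t := by
      intro c t ht
      refine (Finset.sum_le_sum fun j _ => ht (b j.succ.succ)).trans ?_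
      simp
    cases hb : b 0
    · have := key Choice.x (1 + α) (by rintro (_ | _) <;> simp [payoff]; linarith)
      cases b (Fin.succ 0) <;> simp [payoff] at this ⊢ <;> nlinarith
    · have := key Choice.y 2 (by rintro (_ | _) <;> simp [payoff]; norm_num)
      cases b (Fin.succ 0) <;> simp [payoff] at this ⊢ <;> nlinarith

end Star


/-! ### Stable profiles under broad attacks -/

section Stable

variable {V : Type*} [Fintype V] [DecidableEq V] (G : SimpleGraph V)

/-- The indicator of the agents that play `c`. -/
def playInd (a : V → Choice) (c : Choice) (i : V) : ℝ := if a i = c then 1 else 0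

/-- Relative to all `x`, an ordered `y`-`y` pair loses `α` and a miscoordinated one loses `1 + α`;
the factor 2 accounts for both orientations of the latter. -/
theorem welfare_add_loss (α : ℝ) (a : V → Choice) :
    welfare G α a + α * ∑ i, ∑ j, adjWeight G i j * playInd a Choice.y i * playInd a Choice.y j +
      2 * (1 + α) * ∑ i, ∑ j, adjWeight G i j * playInd a Choice.y i * playInd a Choice.x j =
    (1 + α) * ∑ i, ∑ j, adjWeight G i j := by
  have hsymm : ∑ i, ∑ j, adjWeight G i j * playInd a Choice.y i * playInd a Choice.x j =
      ∑ i, ∑ j, adjWeight G i j * playInd a Choice.x i * playInd a Choice.y j := by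
    rw [Finset.sum_comm]
    refine Finset.sum_congr rfl fun i _ => Finset.sum_congr rfl fun j _ => ?_
    rw [adjWeight_comm]
    ring
  rw [mul_comm 2, mul_assoc, two_mul]
  nth_rewrite 2 [hsymm]
  rw [welfare_eq_sum]
  simp only [Finset.mul_sum, ← Finset.sum_add_distrib]
  refine Finset.sum_congr rfl fun i _ => Finset.sum_congr rfl fun j _ => ?_
  cases hi : a i <;> cases hj : a j <;> simp [playInd, payoff, hi, hj] <;> ring

/-- The profile in which the agents in `K` switch to `x`. -/
def switchToX (a : V → Choice) (K : Finset V) (i : V) : Choice := if i ∈ K then Choice.x else a i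

theorem welfare_switchToX (α : ℝ) {a : V → Choice} {K : Finset V}
    (hy : ∀ i ∈ K, a i = Choice.y) (hK : ∀ i ∈ K, ∀ j, G.Adj i j → a j = Choice.y → j ∈ K) :
    welfare G α (switchToX a K) = welfare G α a + α * ∑ i ∈ K, ∑ j ∈ K, adjWeight G i j +
      2 * (1 + α) * ∑ i ∈ K, ∑ j, adjWeight G i j * playInd a Choice.x j := by
  set k : V → ℝ := fun i => if i ∈ K then 1 else 0 with hk
  have hKsum : ∀ f : V → ℝ, ∑ i ∈ K, f i = ∑ i, k i * f i := by
    intro f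
    simp [hk, ite_mul]
  have hsymm : ∑ i, ∑ j, k i * (adjWeight G i j * playInd a Choice.x j) =
      ∑ i, ∑ j, k j * (adjWeight G i j * playInd a Choice.x i) := by
    rw [Finset.sum_comm]
    refine Finset.sum_congr rfl fun i _ => Finset.sum_congr rfl fun j _ => ?_
    rw [adjWeight_comm]
  simp only [hKsum, welfare_eq_sum]
  rw [mul_comm 2 (1 + α), mul_assoc, two_mul]
  simp only [Finset.mul_sum] at hsymm ⊢
  nth_rewrite 2 [hsymm]
  simp only [Finset.mul_sum, ← Finset.sum_add_distrib]
  refine Finset.sum_congr rfl fun i _ => Finset.sum_congr rfl fun j _ => ?_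
  by_cases hadj : G.Adj i j
  · by_cases hi : i ∈ K <;> by_cases hj : j ∈ K
    · simp [switchToX, hk, hi, hj, hy i hi, hy j hj, playInd, payoff]
      ring
    · have hx : a j = Choice.x := by
        cases h : a j
        · rfl
        · exact absurd (hK i hi j hadj h) hj
      simp [switchToX, hk, hi, hj, hy i hi, hx, playInd, payoff]
      ring
    · have hx : a i = Choice.x := by
        cases h : a i
        · rfl
        · exact absurd (hK j hj i hadj.symm h) hi
      simp [switchToX, hk, hi, hj, hy j hj, hx, playInd, payoff]
      ring
    · simp [switchToX, hk, hi, hj]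
  · simp [adjWeight, hadj]

/-- If a component `K` of the `y`-agents does not gain from switching to `x`, it has few edges. -/
theorem edges_le_card_of_stable {α : ℝ} (hα : 0 < α) {S : TargetSet V} {a : V → Choice}
    (h : ∀ b, broadPotential G α S b ≤ broadPotential G α S a) {K : Finset V}
    (hy : ∀ i ∈ K, a i = Choice.y) (hK : ∀ i ∈ K, ∀ j, G.Adj i j → a j = Choice.y → j ∈ K) :
    α * ((∑ i ∈ K, ∑ j ∈ K, adjWeight G i j) / 2) +
      (1 + α) * ∑ i ∈ K, ∑ j, adjWeight G i j * playInd a Choice.x j ≤ K.card := by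
  have hle := h (switchToX a K)
  unfold broadPotential at hle
  rw [welfare_switchToX G α hy hK] at hle
  -- A switching agent forgoes at most the unit paid by a `y`-imposter.
  have himp : ∑ i, imposterTerm α S i (a i) ≤
      ∑ i, imposterTerm α S i (switchToX a K i) + K.card := by
    have : (K.card : ℝ) = ∑ i, if i ∈ K then (1 : ℝ) else 0 := by simp
    rw [this, ← Finset.sum_add_distrib]
    refine Finset.sum_le_sum fun i _ => ?_
    by_cases hi : i ∈ K
    · simp only [switchToX, hi, if_true, hy i hi, imposterTerm]
      split_ifs <;> simp_all <;> linarith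
    · simp [switchToX, hi]
  linarith

/-- `e` is the number of edges inside `K`, at least that of a spanning tree. Its integrality is used
later. -/
theorem exists_edge_count {K : Finset V} (hconn : (G.induce (K : Set V)).Connected) :
    ∃ e : ℕ, ∑ i ∈ K, ∑ j ∈ K, adjWeight G i j = 2 * e ∧ K.card ≤ e + 1 := by
  classical
  refine ⟨(G.induce (K : Set V)).edgeFinset.card, ?_, ?_⟩
  · have h := (G.induce (K : Set V)).sum_degrees_eq_twice_card_edges
    have h' : ((∑ v, (G.induce (K : Set V)).degree v : ℕ) : ℝ) =
        2 * ((G.induce (K : Set V)).edgeFinset.card : ℝ) := by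
      rw [h]
      push_cast
      ring
    rw [← h', ← Finset.sum_coe_sort K]
    push_cast
    refine Finset.sum_congr rfl fun i _ => ?_
    rw [← Finset.sum_coe_sort K, ← SimpleGraph.card_neighborFinset_eq_degree,
      SimpleGraph.neighborFinset_eq_filter, Finset.card_filter]
    push_cast
    refine Finset.sum_congr rfl fun j _ => ?_
    simp [adjWeight]
  · have := hconn.card_vert_le_card_edgeSet_add_one
    rw [Nat.card_eq_fintype_card, Nat.card_eq_fintype_card,
      ← SimpleGraph.edgeFinset_card] at this
    exact (Fintype.card_coe K).symm.trans_le this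

theorem exists_boundary_count (a : V → Choice) (K : Finset V) :
    ∃ c : ℕ, ∑ i ∈ K, ∑ j, adjWeight G i j * playInd a Choice.x j = c := by
  classical
  refine ⟨∑ i ∈ K, ∑ j, if G.Adj i j ∧ a j = Choice.x then 1 else 0, ?_⟩
  push_cast
  refine Finset.sum_congr rfl fun i _ => Finset.sum_congr rfl fun j _ => ?_
  by_cases h1 : G.Adj i j <;> by_cases h2 : a j = Choice.x <;> simp [adjWeight, playInd, h1, h2]

/-- A walk from `K` to an `x`-agent must leave `K`, and by `hK` it can only do so into an `x`-agent.
-/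
theorem boundary_pos (hG : G.Connected) {a : V → Choice} {K : Finset V} (hne : K.Nonempty)
    (hy : ∀ i ∈ K, a i = Choice.y) (hK : ∀ i ∈ K, ∀ j, G.Adj i j → a j = Choice.y → j ∈ K)
    (hx : ∃ i, a i = Choice.x) :
    0 < ∑ i ∈ K, ∑ j, adjWeight G i j * playInd a Choice.x j := by
  obtain ⟨u, hu⟩ := hne
  obtain ⟨v, hv⟩ := hx
  have hvK : v ∉ K := fun h => by simp [hy v h] at hv
  obtain ⟨p⟩ := hG.preconnected u v
  obtain ⟨d, -, h1, h2⟩ := p.exists_boundary_dart (K : Set V) hu hvK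
  have hdx : a d.snd = Choice.x := by
    cases h : a d.snd
    · rfl
    · exact absurd (hK _ h1 _ d.adj h) h2
  have hnn : ∀ i j, 0 ≤ adjWeight G i j * playInd a Choice.x j := fun i j =>
    mul_nonneg (adjWeight_nonneg G i j) (by unfold playInd; split_ifs <;> norm_num)
  refine Finset.sum_pos' (fun i _ => Finset.sum_nonneg fun j _ => hnn i j) ⟨d.fst, h1, ?_⟩
  refine Finset.sum_pos' (fun j _ => hnn _ j) ⟨d.snd, Finset.mem_univ _, ?_⟩
  simp [adjWeight, playInd, hdx]

/-- Integrality does the rounding: if `e + 1 ≤ m c`, then `(1 - α) (e + 1) < c` since `m (1 - α) <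
1`, while `h` makes the left side at least `c + α (c - 1)`. -/
theorem mul_le_of_edge_bound {α : ℝ} {e c : ℕ} (hα0 : 0 < α) (hα : α < 1) (hc : 1 ≤ c) {m : ℕ}
    (hm : (m : ℝ) < α / (1 - α) + 1) (h : α * e + (1 + α) * c ≤ e + 1) : m * c ≤ e := by
  have h1 : 0 < 1 - α := by linarith
  by_contra! hlt
  have hlt' : (e : ℝ) + 1 ≤ m * c := by exact_mod_cast hlt
  have hc' : (1 : ℝ) ≤ c := by exact_mod_cast hc
  have hm' : (m : ℝ) * (1 - α) < 1 := by
    have h2 := mul_lt_mul_of_pos_right hm h1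
    rw [add_mul, div_mul_cancel₀ _ h1.ne'] at h2
    linarith
  have h3 : (1 - α) * (e + 1) ≤ (1 - α) * (m * c) := mul_le_mul_of_nonneg_left hlt' h1.le
  have h4 : (m : ℝ) * (1 - α) * c < 1 * c := mul_lt_mul_of_pos_right hm' (by linarith)
  have h5 : α * 1 ≤ α * c := mul_le_mul_of_nonneg_left hc' hα0.le
  nlinarith

/-- The graph of the interactions between agents that play `y`. -/
def yGraph (a : V → Choice) : SimpleGraph V where
  Adj i j := G.Adj i j ∧ a i = Choice.y ∧ a j = Choice.y
  symm := ⟨fun _ _ h => ⟨h.1.symm, h.2.2, h.2.1⟩⟩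
  loopless := ⟨fun i h => G.loopless.irrefl i h.1⟩

theorem yGraph_reachable_y {a : V → Choice} {i j : V} (h : (yGraph G a).Reachable i j)
    (hi : a i = Choice.y) : a j = Choice.y := by
  obtain ⟨p⟩ := h.symm
  cases p with
  | nil => exact hi
  | cons h _ => exact h.2.1

theorem stable_component {α : ℝ} (hα : 0 < α) (hG : G.Connected) {S : TargetSet V}
    {a : V → Choice} (h : ∀ b, broadPotential G α S b ≤ broadPotential G α S a)
    (hx : ∃ i, a i = Choice.x) {v : V} (hv : a v = Choice.y) {K : Finset V}
    (hKv : ∀ i, i ∈ K ↔ (yGraph G a).Reachable i v) :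
    α < 1 ∧ ∀ m : ℕ, (m : ℝ) < α / (1 - α) + 1 →
      2 * m * ∑ i ∈ K, ∑ j, adjWeight G i j * playInd a Choice.x j ≤
        ∑ i ∈ K, ∑ j, adjWeight G i j * playInd a Choice.y j := by
  have hvK : v ∈ K := (hKv v).2 (SimpleGraph.Reachable.refl v)
  have hy : ∀ i ∈ K, a i = Choice.y := fun i hi => yGraph_reachable_y G ((hKv i).1 hi).symm hv
  have hK : ∀ i ∈ K, ∀ j, G.Adj i j → a j = Choice.y → j ∈ K := by
    intro i hi j hij hj
    have hadj : (yGraph G a).Adj j i := ⟨hij.symm, hj, hy i hi⟩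
    exact (hKv j).2 (hadj.reachable.trans ((hKv i).1 hi))
  have hconn : (G.induce (K : Set V)).Connected := by
    have hsupp : (K : Set V) = ((yGraph G a).connectedComponentMk v).supp := by
      ext i
      simp [hKv, SimpleGraph.ConnectedComponent.eq]
    have h1 : ((yGraph G a).induce (K : Set V)).Connected := by
      rw [hsupp]
      exact ((yGraph G a).connectedComponentMk v).connected_toSimpleGraph
    exact h1.mono fun i j (hij : (yGraph G a).Adj i j) => hij.1
  obtain ⟨e, he, hcard⟩ := exists_edge_count G hconn
  obtain ⟨c, hc⟩ := exists_boundary_count G a K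
  have hcpos := boundary_pos G hG ⟨v, hvK⟩ hy hK hx
  have hle := edges_le_card_of_stable G hα h hy hK
  have hyy : ∑ i ∈ K, ∑ j, adjWeight G i j * playInd a Choice.y j =
      ∑ i ∈ K, ∑ j ∈ K, adjWeight G i j := by
    refine Finset.sum_congr rfl fun i hi => ?_
    rw [← Finset.sum_subset (Finset.subset_univ K)]
    · exact Finset.sum_congr rfl fun j hj => by simp [playInd, hy j hj]
    · intro j _ hj
      by_cases hij : G.Adj i j
      · have : a j ≠ Choice.y := fun h => hj (hK i hi j hij h)
        simp [playInd, this]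
      · simp [adjWeight, hij]
  rw [hyy, he, hc]
  rw [he, hc] at hle
  rw [hc] at hcpos
  have hc1 : 1 ≤ c := by exact_mod_cast hcpos
  have hc1' : (1 : ℝ) ≤ c := by exact_mod_cast hc1
  have hcard' : (K.card : ℝ) ≤ e + 1 := by exact_mod_cast hcard
  have hbound : α * e + (1 + α) * c ≤ e + 1 := by linarith
  -- For `α ≥ 1` and `c ≥ 1` the left side of `hbound` would be at least `e + 2`.
  have hα1 : α < 1 := by
    by_contra! hge
    nlinarith [(e.cast_nonneg : (0 : ℝ) ≤ e)]
  refine ⟨hα1, fun m hm => ?_⟩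
  have := mul_le_of_edge_bound hα hα1 hc1 hm hbound
  have : (m : ℝ) * c ≤ e := by exact_mod_cast this
  linarith

/-- In a stable profile in which both conventions occur, the number of `y`-`y` interactions is at
least `m` times the number of miscoordinations. -/
theorem stable_mixed {α : ℝ} (hα : 0 < α) (hG : G.Connected) {S : TargetSet V}
    {a : V → Choice} (h : ∀ b, broadPotential G α S b ≤ broadPotential G α S a)
    (hx : ∃ i, a i = Choice.x) (hy : ∃ i, a i = Choice.y) :
    α < 1 ∧ ∀ m : ℕ, (m : ℝ) < α / (1 - α) + 1 →
      2 * m * ∑ i, ∑ j, adjWeight G i j * playInd a Choice.y i * playInd a Choice.x j ≤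
        ∑ i, ∑ j, adjWeight G i j * playInd a Choice.y i * playInd a Choice.y j := by
  classical
  constructor
  · obtain ⟨v, hv⟩ := hy
    exact (stable_component G hα hG h hx hv
      (K := Finset.univ.filter fun i => (yGraph G a).Reachable i v) (by simp)).1
  intro m hm
  have hrestrict : ∀ c, ∑ i, ∑ j, adjWeight G i j * playInd a Choice.y i * playInd a c j =
      ∑ i ∈ Finset.univ.filter (fun i => a i = Choice.y),
        ∑ j, adjWeight G i j * playInd a c j := by
    intro c
    rw [Finset.sum_filter]
    refine Finset.sum_congr rfl fun i _ => ?_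
    split_ifs with hi <;> simp [playInd, hi]
  -- Sum the componentwise estimate over the components of `yGraph`; fibres without `y`-agents
  -- contribute nothing.
  rw [hrestrict, hrestrict,
    ← Finset.sum_fiberwise _ (yGraph G a).connectedComponentMk,
    ← Finset.sum_fiberwise _ (yGraph G a).connectedComponentMk, Finset.mul_sum]
  refine Finset.sum_le_sum fun C _ => ?_
  obtain hempty | ⟨v, hv⟩ := (Finset.filter (fun i => (yGraph G a).connectedComponentMk i = C)
    (Finset.univ.filter fun i => a i = Choice.y)).eq_empty_or_nonempty
  · rw [hempty]
    simp
  · simp only [Finset.mem_filter, Finset.mem_univ, true_and] at hv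
    refine (stable_component G hα hG h hx hv.1 fun i => ?_).2 m hm
    simp only [Finset.mem_filter, Finset.mem_univ, true_and, ← hv.2,
      SimpleGraph.ConnectedComponent.eq]
    exact ⟨fun hi => hi.2, fun hi => ⟨yGraph_reachable_y G hi.symm hv.1, hi⟩⟩

/-- Comparison with all `x` gives `α e ≤ N ≤ e + 1`, and `e ≥ 2`, so `α ≤ 1 + 1 / e ≤ 3 / 2`. -/
theorem stable_all_y {α : ℝ} (hα : 0 < α) (hG : G.Connected) (hcard : 3 ≤ Fintype.card V)
    {S : TargetSet V}
    (h : ∀ b, broadPotential G α S b ≤ broadPotential G α S fun _ => Choice.y) : α ≤ 3 / 2 := by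
  have hconn : (G.induce ((Finset.univ : Finset V) : Set V)).Connected := by
    rw [Finset.coe_univ]
    exact (SimpleGraph.induceUnivIso G).connected_iff.2 hG
  obtain ⟨e, he, hc⟩ := exists_edge_count G hconn
  have hle := edges_le_card_of_stable G hα h (K := Finset.univ) (by simp) (by simp)
  rw [he] at hle
  simp only [playInd, reduceCtorEq, if_false, mul_zero, Finset.sum_const_zero, add_zero] at hle
  rw [Finset.card_univ] at hc hle
  have h2 : (2 : ℝ) ≤ e := by exact_mod_cast (by omega : 2 ≤ e)
  have hc' : (Fintype.card V : ℝ) ≤ e + 1 := by exact_mod_cast hc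
  nlinarith

theorem welfare_all_x (α : ℝ) :
    welfare G α (fun _ => Choice.x) = (1 + α) * ∑ i, ∑ j, adjWeight G i j := by
  have := welfare_add_loss G α fun _ => Choice.x
  simpa [playInd] using this

theorem sum_adjWeight_pos (hG : G.Connected) (hcard : 3 ≤ Fintype.card V) :
    0 < ∑ i, ∑ j, adjWeight G i j := by
  have : Nontrivial V := Fintype.one_lt_card_iff_nontrivial.1 (by omega)
  obtain ⟨u⟩ := hG.nonempty
  obtain ⟨v, hv⟩ := hG.preconnected.exists_adj_of_nontrivial u
  refine Finset.sum_pos' (fun i _ => Finset.sum_nonneg fun j _ => adjWeight_nonneg G i j)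
    ⟨u, Finset.mem_univ _, Finset.sum_pos' (fun j _ => adjWeight_nonneg G u j)
      ⟨v, Finset.mem_univ _, ?_⟩⟩
  simp [adjWeight, hv]

end Stable


/-! ### The worst-case broad risk is antitone in the gain -/

/-- Stable profiles are all `x` (no loss), all `y`, or mixed; `hy` and `hmixed` ask `r` to dominate
the worst loss of the last two types. -/
theorem broadRisk_le_of_stable {V : Type*} [Fintype V] [DecidableEq V] {G : SimpleGraph V}
    (hG : G.Connected) (hcard : 3 ≤ Fintype.card V) {αsys α r : ℝ} (hsys : 0 < αsys)
    (hα : 0 < α) (S : TargetSet V) (hr : 0 ≤ r)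
    (hy : α ≤ 3 / 2 → αsys / (1 + αsys) ≤ r)
    (hmixed : α < 1 → ∃ m : ℕ, (m : ℝ) < α / (1 - α) + 1 ∧
      (αsys + 1 / (m + 1)) / (1 + αsys) ≤ r) : broadRisk αsys α G S ≤ r := by
  have hD := sum_adjWeight_pos G hG hcard
  have hsys1 : (0 : ℝ) < 1 + αsys := by linarith
  have hne : Nonempty V := hG.nonempty
  refine broadRisk_le G hsys S (by rw [welfare_all_x]; positivity) fun a ha => ?_
  rw [welfare_all_x]
  have hloss := welfare_add_loss G αsys a
  have hflip : ∀ c, c ≠ Choice.y → c = Choice.x := by rintro (_ | _) <;> simp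
  have hflip' : ∀ c, c ≠ Choice.x → c = Choice.y := by rintro (_ | _) <;> simp
  by_cases hay : ∃ i, a i = Choice.y
  · by_cases hax : ∃ i, a i = Choice.x
    · obtain ⟨h1, h2⟩ := stable_mixed G hα hG ha hax hay
      obtain ⟨m, hm, hmr⟩ := hmixed h1
      have hle := h2 m hm
      set D := ∑ i, ∑ j, adjWeight G i j
      set Y := ∑ i, ∑ j, adjWeight G i j * playInd a Choice.y i * playInd a Choice.y j
      set C := ∑ i, ∑ j, adjWeight G i j * playInd a Choice.y i * playInd a Choice.x j
      have hYC : Y + 2 * C ≤ D := by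
        -- At gain 0 the welfare counts coordinated ordered pairs, among them all `y`-`y` pairs.
        have h0 := welfare_add_loss G 0 a
        have hw0 : 0 ≤ welfare G 0 a - Y := by
          rw [welfare_eq_sum, ← Finset.sum_sub_distrib]
          refine Finset.sum_nonneg fun i _ => ?_
          rw [← Finset.sum_sub_distrib]
          refine Finset.sum_nonneg fun j _ => ?_
          rw [mul_assoc, ← mul_sub]
          refine mul_nonneg (adjWeight_nonneg G i j) ?_
          cases hi : a i <;> cases hj : a j <;> simp [playInd, payoff, hi, hj]
        linarith
      rw [div_le_iff₀ hsys1] at hmr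
      have hm1 : (0 : ℝ) < m + 1 := by positivity
      have h3 : 2 * C ≤ 1 / (m + 1) * D := by
        rw [one_div, inv_mul_eq_div, le_div_iff₀ hm1]
        linarith
      have h4 : (αsys + 1 / (m + 1)) * D ≤ r * (1 + αsys) * D :=
        mul_le_mul_of_nonneg_right hmr hD.le
      -- The loss is `αsys * (Y + 2 * C) + 2 * C`, bounded through `hYC` and `h3`.
      nlinarith
    · have hall : a = fun _ => Choice.y := by
        funext i
        exact hflip' _ fun h => hax ⟨i, h⟩
      subst hall
      have h1 := (div_le_iff₀ hsys1).1 (hy (stable_all_y G hα hG hcard ha))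
      have h2 := mul_le_mul_of_nonneg_right h1 hD.le
      simp [playInd] at hloss
      linarith
  · have hall : a = fun _ => Choice.x := by
      funext i
      exact hflip _ fun h => hay ⟨i, h⟩
    subst hall
    rw [welfare_all_x]
    nlinarith [mul_pos hsys1 hD]

theorem worstBroadRisk_nonneg {αsys : ℝ} (hsys : 0 < αsys) (α : ℝ) :
    0 ≤ worstBroadRisk αsys α := by
  obtain ⟨a, -, ha⟩ := Finset.exists_max_image Finset.univ
    (broadPotential (SimpleGraph.starGraph (0 : Fin 3)) α (targetSetOf fun _ => Choice.y))
    ⟨fun _ => Choice.x, Finset.mem_univ _⟩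
  refine le_trans ?_ (le_worstBroadRisk hsys le_rfl _ a fun b => ha b (Finset.mem_univ b))
  have h1 := welfare_le_all_x (SimpleGraph.starGraph (0 : Fin 3)) hsys a
  simp only [welfare_star _ _ (fun _ => Choice.x), payoff, Finset.sum_const, Finset.card_univ,
    Fintype.card_fin, nsmul_eq_mul] at h1
  rw [sub_nonneg]
  exact div_le_one_of_le₀ h1 (by positivity)

theorem worstBroadRisk_antitone {αsys α α' : ℝ} (hsys : 0 < αsys) (hα : 0 < α) (hle : α ≤ α') :
    worstBroadRisk αsys α' ≤ worstBroadRisk αsys α := by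
  have hα' : 0 < α' := hα.trans_le hle
  refine Real.sSup_le ?_ (worstBroadRisk_nonneg hsys α)
  rintro _ ⟨N, hN, G, hG, S, rfl⟩
  refine broadRisk_le_of_stable hG (by simpa using hN) hsys hα' S (worstBroadRisk_nonneg hsys α)
    (fun h => worstBroadRisk_ge_of_le_three_halves hsys (hle.trans h)) fun h => ?_
  have h1 : 0 < 1 - α' := by linarith
  have h2 : 0 < α' / (1 - α') := div_pos hα' h1
  -- The ceiling satisfies both demands: it is below `α' / (1 - α') + 1`, as the upper bound at `α'`
  -- needs, and it gives `α' (m + 1) ≤ m`, which passes to `α ≤ α'` and makes the star attack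
  -- stable.
  refine ⟨⌈α' / (1 - α')⌉₊, Nat.ceil_lt_add_one h2.le,
    worstBroadRisk_ge_of_mul_le hsys hα (Nat.ceil_pos.2 h2) ?_⟩
  have h3 := (div_le_iff₀ h1).1 (Nat.le_ceil (α' / (1 - α')))
  have h4 : (0 : ℝ) ≤ (⌈α' / (1 - α')⌉₊ : ℝ) + 1 := by positivity
  nlinarith

end CoordGame

theorem corollary1 (αsys : ℝ) (hsys : 0 < αsys) (γf : ℝ) (hγ : γf ∈ Set.Ico (0 : ℝ) 1)
    (α : ℝ) (hα : 0 < α) (hf : CoordGame.worstFocusedRisk αsys α ≤ γf) :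
    CoordGame.worstBroadRisk αsys α ≥
      CoordGame.worstBroadRisk αsys ((1 + αsys) / (1 - γf) - 1) :=
  CoordGame.worstBroadRisk_antitone hsys hα
    (CoordGame.gain_le_of_worstFocusedRisk_le hsys hα hγ.2 hf)
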